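/- **Proposition (approximation of $\sqrt{1-e^{-t}}$ by attention-only Transformers).** *Model class.* For $\lambda>0$ let $\mathrm{Softmax}_\lambda(u)_i=e^{\lambda u_i}/\sum_j e^{\lambda u_j}$, applied column-wise to matrices. An $H$-head attention layer is a map $Z\mapsto\sum_{h=1}^H W_V^{(h)}Z\,\mathrm{Softmax}_\lambda\big((W_K^{(h)}Z)^\top W_Q^{(h)}Z\big)$ with $W_K^{(h)},W_Q^{(h)}\in\mathbb R^{d_h\times d_{\rm in}}$, $W_V^{(h)}\in\mathbb R^{d_{\rm out}\times d_{\rm in}}$; put $W_{KQ}^{(h)}=(W_K^{(h)})^\top W_Q^{(h)}$. For $X\in\mathbb R^{d\times n}$ let $$P(X)=\begin{bmatrix}X&0\\ I_n&0\\ 0&1\end{bmatrix}\in\mathbb R^{(d+n+1)\times(n+1)},$$ and let $T$ delete the last column. The class $\mathcal T(H,W,K,C_{KQ},C_V)$, $C_{KQ},C_V>0$, with inverse temperature $\lambda>0$, consists of all maps $T\circ\mathrm{Attn}^{(K)}\circ\cdots\circ\mathrm{Attn}^{(1)}\circ P$ in which each $\mathrm{Attn}^{(j)}:\mathbb R^{d_j\times(n+1)}\to\mathbb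 R^{d_{j+1}\times(n+1)}$ ($d_1=d+n+1$) is an $H$-head layer with this $\lambda$, $W$ is the maximum of all token dimensions $d_1,\dots,d_{K+1}$ and all head dimensions, and $C_V$, $C_{KQ}$ are the maxima over all layers and heads of $\|W_V\|_F$ and $\|W_{KQ}\|_F$. A real number $t$ is regarded as an input with $d=n=1$, and the output dimension is $1$. *Statement.* There are a constant $C>0$ and a real polynomial $p$ such that for every $\epsilon\in(0,1)$ and every $C_X>\epsilon$ there is $f_\sigma\in\mathcal T(H,W,K,C_{KQ},C_V)$, for some $H,W,K,C_{KQ},C_V$ and some inverse temperature $\lambda>0$, with $$\big|f_\sigma(t)-\sqrt{1-e^{-t}}\big|\le\epsilon\qquad\text{for all }\epsilon\le t\le C_X,$$ and such that, writing $\delta=1/\epsilon$, if moreover $C_X\ge1$ and $\epsilon\le\tfrac12$, then the parameters of $f_\sigma$ satisfy $$H\le C\ln^3\delta,\qquad W\le C\ln^3\delta,\qquad K\le C\ln^2\delta,$$ $$C_V\le \exp(C\ln^2\delta)\cdot C\sqrt{\ln^3\delta},\qquad C_{KQ}\le C\sqrt{\ln^2\delta\,(\ln^2\delta+\ln C_X)},$$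 $$\lambda\le \exp(C\ln^4\delta)\cdot C\,(\ln\delta)^{p(\ln\delta)}\,(1+\ln C_X).$$ -/

import Mathlib

noncomputable section

namespace AttnOnly

open scoped Matrix

/-- Softmax with inverse temperature `lam` of a vector. -/
def softmax (lam : ℝ) {m : ℕ} (u : Fin m → ℝ) : Fin m → ℝ :=
  fun i => Real.exp (lam * u i) / ∑ j, Real.exp (lam * u j)

/-- Column-wise softmax of a matrix. -/
def colSoftmax (lam : ℝ) {m n : ℕ} (X : Matrix (Fin m) (Fin n) ℝ) :
    Matrix (Fin m) (Fin n) ℝ :=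
  Matrix.of fun i k => softmax lam (fun r => X r k) i

/-- The weights of one attention head; `dim` is the head dimension, which may differ from head
to head. -/
structure AttnHead (dIn dOut : ℕ) where
  dim : ℕ
  WK : Matrix (Fin dim) (Fin dIn) ℝ
  WQ : Matrix (Fin dim) (Fin dIn) ℝ
  WV : Matrix (Fin dOut) (Fin dIn) ℝ

/-- The product of the transposed key matrix with the query matrix. -/
def AttnHead.WKQ {dIn dOut : ℕ} (h : AttnHead dIn dOut) : Matrix (Fin dIn) (Fin dIn) ℝ :=
  h.WKᵀ * h.WQ

/-- The weights of a self-attention layer with `H` heads. -/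
abbrev AttnLayer (H dIn dOut : ℕ) : Type := Fin H → AttnHead dIn dOut

/-- The map `Z ↦ ∑ h, W_V Z Softmax((W_K Z)ᵀ (W_Q Z))` of a multi-head self-attention layer
acting on sequences of `m` tokens. -/
def attn (lam : ℝ) {H dIn dOut m : ℕ} (L : AttnLayer H dIn dOut)
    (Z : Matrix (Fin dIn) (Fin m) ℝ) : Matrix (Fin dOut) (Fin m) ℝ :=
  ∑ h, (L h).WV * Z * colSoftmax lam (((L h).WK * Z)ᵀ * ((L h).WQ * Z))

/-- `AttnStack H K dIn dOut`: the weights of `K` composable attention layers with `H` heads each,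
from token dimension `dIn` to token dimension `dOut`. In `cons L S` the layer `L` is applied
first. -/
inductive AttnStack (H : ℕ) : ℕ → ℕ → ℕ → Type
  | nil (d : ℕ) : AttnStack H 0 d d
  | cons {K d₁ d₂ d₃ : ℕ} (L : AttnLayer H d₁ d₂) (S : AttnStack H K d₂ d₃) :
      AttnStack H (K + 1) d₁ d₃

namespace AttnStack

/-- The composition of the layers. -/
def eval (lam : ℝ) {H m : ℕ} : {K dIn dOut : ℕ} → AttnStack H K dIn dOut →
    Matrix (Fin dIn) (Fin m) ℝ → Matrix (Fin dOut) (Fin m) ℝ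
  | _, _, _, nil _, Z => Z
  | _, _, _, cons L S, Z => S.eval lam (attn lam L Z)

/-- All token dimensions (input, intermediate, output) and all head dimensions. -/
def dims {H : ℕ} : {K dIn dOut : ℕ} → AttnStack H K dIn dOut → Set ℕ
  | _, _, _, nil d => {d}
  | _, dIn, _, cons L S => {dIn} ∪ Set.range (fun h => (L h).dim) ∪ S.dims

open scoped Matrix.Norms.Frobenius in
/-- The Frobenius norms of all value matrices. -/
def normsV {H : ℕ} : {K dIn dOut : ℕ} → AttnStack H K dIn dOut → Set ℝ
  | _, _, _, nil _ => ∅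
  | _, _, _, cons L S => Set.range (fun h => ‖(L h).WV‖) ∪ S.normsV

open scoped Matrix.Norms.Frobenius in
/-- The Frobenius norms of all key-query products. -/
def normsKQ {H : ℕ} : {K dIn dOut : ℕ} → AttnStack H K dIn dOut → Set ℝ
  | _, _, _, nil _ => ∅
  | _, _, _, cons L S => Set.range (fun h => ‖(L h).WKQ‖) ∪ S.normsKQ

end AttnStack

/-- The preprocessing layer: it pads one zero token and appends one-hot positional encodings,
`X ↦ [X, 0; I_n, 0; 0, 1]`. -/
def preprocess {d n : ℕ} (X : Matrix (Fin d) (Fin n) ℝ) :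
    Matrix (Fin (d + n + 1)) (Fin (n + 1)) ℝ :=
  Matrix.of fun i j =>
    Fin.lastCases (motive := fun _ => ℝ)
      (Fin.append (Fin.append (0 : Fin d → ℝ) (0 : Fin n → ℝ)) (1 : Fin 1 → ℝ) i)
      (fun k => Fin.append (Fin.append (fun r => X r k) (Pi.single k 1)) (0 : Fin 1 → ℝ) i) j

/-- The truncation layer: it deletes the last token. -/
def truncate {d n : ℕ} (Z : Matrix (Fin d) (Fin (n + 1)) ℝ) : Matrix (Fin d) (Fin n) ℝ :=
  Matrix.of fun i j => Z i j.castSucc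

/-- The class of attention-only Transformers `T ∘ Attn_K ∘ ⋯ ∘ Attn_1 ∘ P` with `H` heads per
layer, width `W`, depth `K`, inverse temperature `lam`, and maximal Frobenius norms `CKQ` of the
key-query products and `CV` of the value matrices. -/
def TransformerClass (d n dOut H W K : ℕ) (lam CKQ CV : ℝ) :
    Set (Matrix (Fin d) (Fin n) ℝ → Matrix (Fin dOut) (Fin n) ℝ) :=
  {τ | 0 < lam ∧ 0 < CKQ ∧ 0 < CV ∧
    ∃ S : AttnStack H K (d + n + 1) dOut,
      IsGreatest S.dims W ∧ IsGreatest S.normsKQ CKQ ∧ IsGreatest S.normsV CV ∧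
      ∀ X, τ X = truncate (S.eval lam (preprocess X))}

end AttnOnly

end

/-! Put `y = exp (-t)` and take `n` about `log₂ (1/ε)`. The power series of `√(1 - y)` has
coefficients of modulus at most 1, and since `1 - y` is at least about `2^(-n)`, its first
`2^(3n+3)` terms suffice. That is too many monomials, so they are compressed: if `2j ≤ N`, then
`y^(N+j) = y^N (1 - (1-y))^j` is within `2^(-m)` of the binomial expansion cut after `m` terms
(`abs_pow_add_sub_le`), because `y^N` is small where `1 - y` is not. Two base exponents `N` per
dyadic block then leave `O(n²)` monomials with coefficients `2^(O(n²))` (`exists_sparse_approx`).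

Each monomial `y^e = exp (-e t)` is the tail of a sigmoid, and one head with the padding token
computes a sigmoid of an affine function (`attn_sigmoidHead`). One layer of width 3 therefore
suffices, with error bounds uniform in large `t`; the steep slopes are absorbed by the inverse
temperature. -/

/-! ### Truncated binomial expansions -/

open Finset in
/-- The partial sums of the binomial expansion of `(1 - z) ^ j`. -/
theorem abs_one_sub_pow_sub_sum_le (j m : ℕ) {z : ℝ} (h0 : 0 ≤ z) (h1 : z ≤ 1) :
    |(1 - z) ^ j - ∑ i ∈ range m, (j.choose i : ℝ) * (-z) ^ i| ≤ j.choose m * z ^ m := by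
  induction j generalizing m with
  | zero =>
    cases m with
    | zero => simp
    | succ m => simp [sum_range_succ']
  | succ j ih =>
    cases m with
    | zero =>
      have : |(1 - z) ^ (j + 1)| ≤ 1 := by
        rw [abs_of_nonneg (pow_nonneg (by linarith) _)]
        exact pow_le_one₀ (by linarith) (by linarith)
      simpa using this
    | succ m =>
      -- Pascal's rule; it makes the remainders, and hence their bounds, obey the same recursion.
      have key : ∑ i ∈ range (m + 1), ((j + 1).choose i : ℝ) * (-z) ^ i =
          ∑ i ∈ range (m + 1), (j.choose i : ℝ) * (-z) ^ i
            - z * ∑ i ∈ range m, (j.choose i : ℝ) * (-z) ^ i := by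
        rw [sum_range_succ', sum_range_succ' (fun i => (j.choose i : ℝ) * (-z) ^ i), mul_sum]
        simp only [Nat.choose_succ_succ, Nat.cast_add, add_mul, sum_add_distrib, pow_succ,
          Nat.choose_zero_right]
        have : ∑ x ∈ range m, (j.choose x : ℝ) * ((-z) ^ x * -z) =
            - ∑ x ∈ range m, z * ((j.choose x : ℝ) * (-z) ^ x) := by
          rw [← sum_neg_distrib]
          exact sum_congr rfl fun x _ => by ring
        rw [this]
        ring
      rw [key]
      have e : (1 - z) ^ (j + 1) - (∑ i ∈ range (m + 1), (j.choose i : ℝ) * (-z) ^ i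
            - z * ∑ i ∈ range m, (j.choose i : ℝ) * (-z) ^ i) =
          ((1 - z) ^ j - ∑ i ∈ range (m + 1), (j.choose i : ℝ) * (-z) ^ i)
          - z * ((1 - z) ^ j - ∑ i ∈ range m, (j.choose i : ℝ) * (-z) ^ i) := by ring
      rw [e]
      refine (abs_sub _ _).trans ?_
      rw [abs_mul, abs_of_nonneg h0]
      have a := ih (m + 1)
      have b := mul_le_mul_of_nonneg_left (ih m) h0
      rw [Nat.choose_succ_succ]
      push_cast
      rw [pow_succ] at a ⊢
      linarith

/-- Compare successive ratios in `m`: `2 (j - m) ≤ 2 j - m`. The factor `2 ^ m` becomes the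
geometric gain of the expansion. -/
theorem two_pow_mul_choose_le (j m : ℕ) : 2 ^ m * j.choose m ≤ (2 * j).choose m := by
  induction m with
  | zero => simp
  | succ m ih =>
    refine Nat.le_of_mul_le_mul_right (c := m + 1) ?_ (by omega)
    rw [Nat.choose_succ_right_eq, mul_assoc, Nat.choose_succ_right_eq]
    calc 2 ^ (m + 1) * (j.choose m * (j - m)) = 2 ^ m * j.choose m * (2 * (j - m)) := by ring
      _ ≤ (2 * j).choose m * (2 * j - m) := Nat.mul_le_mul ih (by omega)

/-- The left side is one term of the expansion of `((1 - y) + y) ^ (N + m) = 1`, whose terms are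
nonnegative. -/
theorem choose_mul_pow_mul_pow_le_one (N m : ℕ) {y : ℝ} (h0 : 0 ≤ y) (h1 : y ≤ 1) :
    ((N + m).choose m : ℝ) * ((1 - y) ^ m * y ^ N) ≤ 1 := by
  have h := add_pow (1 - y) y (N + m)
  rw [sub_add_cancel, one_pow] at h
  have h1' : 0 ≤ 1 - y := by linarith
  have := Finset.single_le_sum
    (f := fun i => (1 - y) ^ i * y ^ (N + m - i) * ((N + m).choose i : ℝ))
    (s := Finset.range (N + m + 1)) (fun i _ => by positivity)
    (Finset.mem_range.2 (show m < N + m + 1 by omega))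
  simp only [Nat.add_sub_cancel] at this
  linarith

/-- For `0 ≤ y ≤ 1` the power `y ^ (N + j)` with `2 j ≤ N` is well approximated by `y ^ N` times
a polynomial of small degree. -/
theorem abs_pow_add_sub_le {N j : ℕ} (m : ℕ) (hj : 2 * j ≤ N) {y : ℝ} (h0 : 0 ≤ y) (h1 : y ≤ 1) :
    |y ^ (N + j) - y ^ N * ∑ i ∈ Finset.range m, (j.choose i : ℝ) * (-(1 - y)) ^ i|
      ≤ (1 / 2) ^ m := by
  have h := abs_one_sub_pow_sub_sum_le j m (z := 1 - y) (by linarith) (by linarith)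
  rw [sub_sub_cancel] at h
  rw [pow_add, ← mul_sub, abs_mul, abs_of_nonneg (pow_nonneg h0 N)]
  have h1' : 0 ≤ 1 - y := by linarith
  have c : (2 : ℝ) ^ m * j.choose m ≤ (N + m).choose m := by
    exact_mod_cast (two_pow_mul_choose_le j m).trans (Nat.choose_le_choose m (by omega))
  have d := (mul_le_mul_of_nonneg_right c
    (show 0 ≤ (1 - y) ^ m * y ^ N by positivity)).trans (choose_mul_pow_mul_pow_le_one N m h0 h1)
  rw [one_div, inv_pow, ← one_div, le_div_iff₀ (by positivity)]
  have := mul_le_mul_of_nonneg_left h (pow_nonneg h0 N)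
  nlinarith [pow_pos (two_pos : (0 : ℝ) < 2) m]

/-- The coefficients of the truncated expansion of `y ^ j` in powers of `1 - y`. -/
def newtonCoeff (m j l : ℕ) : ℝ :=
  ∑ i ∈ Finset.range m, (j.choose i : ℝ) * (-1) ^ i * ((i.choose l : ℝ) * (-1) ^ l)

open Finset in
theorem sum_choose_mul_pow_eq (m j : ℕ) (y : ℝ) :
    ∑ i ∈ range m, (j.choose i : ℝ) * (-(1 - y)) ^ i =
      ∑ l ∈ range m, newtonCoeff m j l * y ^ l := by
  simp only [newtonCoeff, sum_mul]
  rw [sum_comm]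
  refine sum_congr rfl fun i hi => ?_
  have hi := mem_range.1 hi
  have : (1 - y) ^ i = ∑ l ∈ range m, (i.choose l : ℝ) * (-1) ^ l * y ^ l := by
    rw [← sum_subset (range_subset_range.2 (show i + 1 ≤ m from hi))]
    · rw [sub_eq_neg_add, add_pow]
      refine sum_congr rfl fun l _ => ?_
      rw [one_pow, neg_pow]
      ring
    · intro l _ hl
      rw [Nat.choose_eq_zero_of_lt (by simpa using hl)]
      simp
  rw [neg_pow, this, mul_sum, mul_sum]
  exact sum_congr rfl fun l _ => by ring

theorem abs_newtonCoeff_le {m j l M : ℕ} (hM : 1 ≤ M) (hj : j ≤ M) :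
    |newtonCoeff m j l| ≤ m * (M ^ m * 2 ^ m) := by
  refine (Finset.abs_sum_le_sum_abs _ _).trans ?_
  have : ∀ i ∈ Finset.range m,
      |(j.choose i : ℝ) * (-1) ^ i * ((i.choose l : ℝ) * (-1) ^ l)| ≤ M ^ m * 2 ^ m := by
    intro i hi
    have hi := Finset.mem_range.1 hi
    simp only [abs_mul, abs_pow, abs_neg, abs_one, one_pow, mul_one, Nat.abs_cast]
    have a : j.choose i ≤ M ^ m :=
      (Nat.choose_le_pow j i).trans ((Nat.pow_le_pow_left hj i).trans
        (Nat.pow_le_pow_right hM hi.le))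
    have b : i.choose l ≤ 2 ^ m :=
      (Nat.choose_le_two_pow i l).trans (Nat.pow_le_pow_right (by norm_num) hi.le)
    exact_mod_cast Nat.mul_le_mul a b
  simpa using Finset.sum_le_card_nsmul _ _ _ this

/-! ### Compression to few monomials -/

/-- Each dyadic block is split at its midpoint: its left end and its midpoint both lie within half
their own size of the exponents they serve. -/
theorem exists_base_points (A : ℕ) :
    ∃ B : Finset ℕ, B.card ≤ 2 * A + 2 ∧
      ∀ k < 2 ^ (A + 1), ∃ N ∈ B, N ≤ k ∧ 2 * (k - N) ≤ N := by
  induction A with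
  | zero =>
    refine ⟨{0, 1}, by simp, fun k hk => ⟨k, ?_, le_rfl, by omega⟩⟩
    have : k < 2 := by simpa using hk
    interval_cases k <;> simp
  | succ A ih =>
    obtain ⟨B, hB, h⟩ := ih
    refine ⟨insert (2 * 2 ^ A) (insert (3 * 2 ^ A) B), ?_, fun k hk => ?_⟩
    · have := Finset.card_insert_le (2 * 2 ^ A) (insert (3 * 2 ^ A) B)
      have := Finset.card_insert_le (3 * 2 ^ A) B
      omega
    · rw [pow_succ, pow_succ] at hk
      rcases lt_or_ge k (2 ^ (A + 1)) with h1 | h1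
      · obtain ⟨N, hN, h'⟩ := h k h1
        exact ⟨N, by simp [hN], h'⟩
      · rw [pow_succ] at h1
        rcases lt_or_ge k (3 * 2 ^ A) with h2 | h2
        · exact ⟨2 * 2 ^ A, by simp, by omega, by omega⟩
        · exact ⟨3 * 2 ^ A, by simp, by omega, by omega⟩

open Finset in
/-- Compression of a polynomial with bounded coefficients, on the unit interval, to few
monomials. -/
theorem exists_sparse_approx (w : ℕ → ℝ) (hw : ∀ k, |w k| ≤ 1) (A m : ℕ) :
    ∃ (B : Finset ℕ) (c : ℕ → ℕ → ℝ), B.card ≤ 2 * A + 2 ∧ (∀ N ∈ B, N ≤ 2 ^ (A + 1)) ∧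
      (∀ N l, |c N l| ≤ 2 ^ (A + 1) * (m * ((2 ^ (A + 1)) ^ m * 2 ^ m))) ∧
      ∀ y : ℝ, 0 ≤ y → y ≤ 1 →
        |∑ k ∈ range (2 ^ (A + 1)), w k * y ^ k
          - ∑ q ∈ B ×ˢ range m, c q.1 q.2 * y ^ (q.1 + q.2)| ≤ 2 ^ (A + 1) * (1 / 2) ^ m := by
  obtain ⟨B, hB, h⟩ := exists_base_points A
  choose! base hmem hle htwo using h
  -- Filtering secures the size bound and loses no base in use, since `base k ≤ k`. The coefficient
  -- at `N` collects all exponents with base `N`.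
  refine ⟨B.filter (· ≤ 2 ^ (A + 1)),
    fun N l => ∑ k ∈ range (2 ^ (A + 1)) with base k = N, w k * newtonCoeff m (k - N) l,
    (card_le_card (filter_subset _ _)).trans hB, fun N hN => (mem_filter.1 hN).2, ?_, ?_⟩
  · intro N l
    have hb : ∀ k ∈ (range (2 ^ (A + 1))).filter (base · = N),
        |w k * newtonCoeff m (k - N) l| ≤ m * ((2 ^ (A + 1)) ^ m * 2 ^ m) := by
      intro k hk
      have hk := mem_range.1 (mem_filter.1 hk).1
      rw [abs_mul]
      have := abs_newtonCoeff_le (m := m) (l := l) (j := k - N) (M := 2 ^ (A + 1))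
        Nat.one_le_two_pow (by omega)
      push_cast at this
      exact (mul_le_of_le_one_left (abs_nonneg _) (hw k)).trans this
    refine (abs_sum_le_sum_abs _ _).trans ((sum_le_card_nsmul _ _ _ hb).trans ?_)
    rw [nsmul_eq_mul]
    gcongr
    have := card_filter_le (range (2 ^ (A + 1))) (base · = N)
    rw [card_range] at this
    exact_mod_cast this
  · intro y h0 h1
    have e : ∑ q ∈ B.filter (· ≤ 2 ^ (A + 1)) ×ˢ range m,
        (∑ k ∈ range (2 ^ (A + 1)) with base k = q.1, w k * newtonCoeff m (k - q.1) q.2)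
          * y ^ (q.1 + q.2) =
        ∑ k ∈ range (2 ^ (A + 1)), w k * (y ^ base k *
          ∑ i ∈ range m, ((k - base k).choose i : ℝ) * (-(1 - y)) ^ i) := by
      rw [sum_product, ← sum_fiberwise_of_maps_to (s := range (2 ^ (A + 1)))
        (t := B.filter (· ≤ 2 ^ (A + 1))) (g := base)]
      · refine sum_congr rfl fun N _ => ?_
        simp only [sum_mul]
        rw [sum_comm]
        refine sum_congr rfl fun k hk => ?_
        rw [(mem_filter.1 hk).2, sum_choose_mul_pow_eq, mul_sum, mul_sum]
        exact sum_congr rfl fun l _ => by ring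
      · intro k hk
        have hk := mem_range.1 hk
        exact mem_filter.2 ⟨hmem k hk, (hle k hk).trans hk.le⟩
    rw [e, ← sum_sub_distrib]
    refine (abs_sum_le_sum_abs _ _).trans ?_
    have hb : ∀ k ∈ range (2 ^ (A + 1)), |w k * y ^ k - w k * (y ^ base k *
          ∑ i ∈ range m, ((k - base k).choose i : ℝ) * (-(1 - y)) ^ i)| ≤ (1 / 2) ^ m := by
      intro k hk
      have hk := mem_range.1 hk
      have := abs_pow_add_sub_le m (htwo k hk) h0 h1
      rw [Nat.add_sub_cancel' (hle k hk)] at this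
      rw [← mul_sub, abs_mul]
      exact (mul_le_of_le_one_left (abs_nonneg _) (hw k)).trans this
    simpa using sum_le_card_nsmul _ _ _ hb

/-! ### Power series of the square root -/

theorem abs_ringChoose_half_le_one (k : ℕ) : |Ring.choose (1 / 2 : ℝ) k| ≤ 1 := by
  have hrec : ∀ k : ℕ, Ring.choose (1 / 2 : ℝ) (k + 1) * (k + 1)
      = Ring.choose (1 / 2 : ℝ) k * (1 / 2 - k) := by
    intro k
    have := Ring.choose_smul_choose (1 / 2 : ℝ) (Nat.le_succ k)
    simpa [mul_comm] using this
  induction k with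
  | zero => simp
  | succ k ih =>
    have h := congrArg abs (hrec k)
    rw [abs_mul, abs_mul, abs_of_nonneg (by positivity : (0 : ℝ) ≤ k + 1)] at h
    have hk : |(1 / 2 : ℝ) - k| ≤ k + 1 := by
      have : (0 : ℝ) ≤ k := k.cast_nonneg
      rw [abs_le]; constructor <;> linarith
    have : |Ring.choose (1 / 2 : ℝ) (k + 1)| * (k + 1) ≤ 1 * (k + 1) := by
      rw [h]; exact mul_le_mul ih hk (abs_nonneg _) zero_le_one
    exact le_of_mul_le_mul_right this (by positivity)

/-- The power series of `√(1 - y)`, with a bound for its tails. -/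
theorem exists_sqrt_one_sub_approx :
    ∃ w : ℕ → ℝ, (∀ k, |w k| ≤ 1) ∧ ∀ y : ℝ, 0 ≤ y → y < 1 → ∀ M : ℕ,
      |Real.sqrt (1 - y) - (1 + y * ∑ k ∈ Finset.range M, w k * y ^ k)| ≤ y ^ M / (1 - y) := by
  let a : ℕ → ℝ := fun k => Ring.choose (1 / 2 : ℝ) k * (-1) ^ k
  have ha : ∀ k, |a k| ≤ 1 := fun k => by simpa [a, abs_mul] using abs_ringChoose_half_le_one k
  refine ⟨fun k => a (k + 1), fun k => ha _, fun y h0 h1 M => ?_⟩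
  have hs : HasSum (fun k => a k * y ^ k) (Real.sqrt (1 - y)) := by
    have := (Real.one_add_rpow_hasFPowerSeriesOnBall_zero (a := 1 / 2)).hasSum (y := -y) (by
      rw [← ENNReal.ofReal_one, Metric.eball_ofReal]
      simpa [abs_of_nonneg h0] using h1)
    simp only [binomialSeries_apply, zero_add, List.ofFn_const, List.prod_replicate] at this
    rw [Real.sqrt_eq_rpow, sub_eq_add_neg]
    have e : (fun k => a k * y ^ k) = fun k => Ring.choose (1 / 2 : ℝ) k • (-y) ^ k := by
      funext k
      rw [smul_eq_mul, neg_pow y]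
      simp only [a]
      ring
    rwa [e]
  have ht := (hasSum_nat_add_iff' (M + 1)).2 hs
  have e : ∑ k ∈ Finset.range (M + 1), a k * y ^ k =
      1 + y * ∑ k ∈ Finset.range M, a (k + 1) * y ^ k := by
    rw [Finset.sum_range_succ', add_comm, Finset.mul_sum]
    congr 1
    · simp [a]
    · exact Finset.sum_congr rfl fun k _ => by ring
  rw [e] at ht
  have hg : HasSum (fun k => y ^ M * y ^ k) (y ^ M / (1 - y)) := by
    simpa [div_eq_mul_inv] using (hasSum_geometric_of_lt_one h0 h1).mul_left (y ^ M)
  rw [← ht.tsum_eq, ← hg.tsum_eq, ← Real.norm_eq_abs]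
  refine tsum_of_norm_bounded hg.summable.hasSum fun k => ?_
  rw [Real.norm_eq_abs, abs_mul, abs_of_nonneg (pow_nonneg h0 _), ← pow_add]
  refine (mul_le_of_le_one_left (pow_nonneg h0 _) (ha _)).trans ?_
  exact pow_le_pow_of_le_one h0 h1.le (by omega)

/-! ### Sigmoids as attention heads -/

namespace AttnOnly

open scoped Matrix

theorem preprocess_scalar (t : ℝ) :
    preprocess (Matrix.of fun (_ : Fin 1) (_ : Fin 1) => t) =
      (!![t, 0; 1, 0; 0, 1] : Matrix (Fin 3) (Fin 2) ℝ) := by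
  ext i j
  fin_cases i <;> fin_cases j <;> rfl

/-- A head that realises `t ↦ v / (1 + exp (lam * (a * t + b)))` on a scalar input. -/
def sigmoidHead (v a b : ℝ) : AttnHead (1 + 1 + 1) 1 where
  dim := 1
  WK := (!![0, 1, 0] : Matrix (Fin 1) (Fin 3) ℝ)
  WQ := (!![-a, -b, 0] : Matrix (Fin 1) (Fin 3) ℝ)
  WV := (!![0, v, 0] : Matrix (Fin 1) (Fin 3) ℝ)

theorem attn_sigmoidHead (lam : ℝ) {H : ℕ} (v a b : Fin H → ℝ) (t : ℝ) :
    attn lam (fun h => sigmoidHead (v h) (a h) (b h))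
      (preprocess (Matrix.of fun (_ : Fin 1) (_ : Fin 1) => t)) 0 0 =
      ∑ h, v h * (Real.exp (-(lam * (a h * t + b h))) /
        (Real.exp (-(lam * (a h * t + b h))) + 1)) := by
  rw [preprocess_scalar, attn, Matrix.sum_apply]
  refine Finset.sum_congr rfl fun h _ => ?_
  have e : lam * (-(a h * t) + -b h) = -(lam * (a h * t + b h)) := by ring
  -- In the first column the real token scores `-(a t + b)` and the padding token scores 0, giving
  -- the `+ 1` in the denominator. Only the real token has a nonzero value.
  change ((!![0, v h, 0] : Matrix (Fin 1) (Fin 3) ℝ) * (!![t, 0; 1, 0; 0, 1] : Matrix _ (Fin 2) ℝ) *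
    colSoftmax lam (((!![0, 1, 0] : Matrix (Fin 1) (Fin 3) ℝ) * !![t, 0; 1, 0; 0, 1])ᵀ *
      ((!![-a h, -b h, 0] : Matrix (Fin 1) (Fin 3) ℝ) * !![t, 0; 1, 0; 0, 1]))) 0 0 = _
  simp [colSoftmax, softmax, Matrix.mul_apply, Matrix.transpose_apply, Fin.sum_univ_succ, e]

open scoped Matrix.Norms.Frobenius

theorem norm_sigmoidHead_WV (v a b : ℝ) : ‖(sigmoidHead v a b).WV‖ = |v| := by
  change ‖(!![0, v, 0] : Matrix (Fin 1) (Fin 3) ℝ)‖ = |v|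
  rw [Matrix.frobenius_norm_def, ← Real.sqrt_eq_rpow]
  simp [Fin.sum_univ_succ, Real.sqrt_sq_eq_abs]

theorem norm_sigmoidHead_WKQ (v a b : ℝ) :
    ‖(sigmoidHead v a b).WKQ‖ = Real.sqrt (a ^ 2 + b ^ 2) := by
  change ‖(!![0, 1, 0] : Matrix (Fin 1) (Fin 3) ℝ)ᵀ *
    (!![-a, -b, 0] : Matrix (Fin 1) (Fin 3) ℝ)‖ = _
  rw [Matrix.frobenius_norm_def, ← Real.sqrt_eq_rpow]
  simp [Fin.sum_univ_succ, Matrix.mul_apply]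

/-- Sums of sigmoids of affine functions are single-layer attention-only Transformers. -/
theorem exists_transformer_eq_sum_sigmoid {H : ℕ} {lam V R : ℝ} (hlam : 0 < lam)
    (v a b : Fin H → ℝ) {h₀ : Fin H} (hv₀ : v h₀ ≠ 0) (hb₀ : b h₀ ≠ 0) (hV : ∀ h, |v h| ≤ V)
    (hR : ∀ h, Real.sqrt (a h ^ 2 + b h ^ 2) ≤ R) :
    ∃ CKQ CV : ℝ, CKQ ≤ R ∧ CV ≤ V ∧ ∃ f ∈ TransformerClass 1 1 1 H 3 1 lam CKQ CV,
      ∀ t : ℝ, f (Matrix.of fun _ _ => t) 0 0 =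
        ∑ h, v h * (Real.exp (-(lam * (a h * t + b h))) /
          (Real.exp (-(lam * (a h * t + b h))) + 1)) := by
  have : Nonempty (Fin H) := ⟨h₀⟩
  obtain ⟨i, hi⟩ := Finite.exists_max fun h => |v h|
  obtain ⟨j, hj⟩ := Finite.exists_max fun h => Real.sqrt (a h ^ 2 + b h ^ 2)
  let S : AttnStack H 1 (1 + 1 + 1) 1 :=
    .cons (fun h => sigmoidHead (v h) (a h) (b h)) (.nil 1)
  refine ⟨Real.sqrt (a j ^ 2 + b j ^ 2), |v i|, hR j, hV i,
    fun X => truncate (S.eval lam (preprocess X)),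
    ⟨hlam, ?_, (abs_pos.2 hv₀).trans_le (hi h₀), S, ?_, ?_, ?_, fun X => rfl⟩,
    fun t => attn_sigmoidHead lam v a b t⟩
  · refine lt_of_lt_of_le (Real.sqrt_pos.2 ?_) (hj h₀)
    have := sq_nonneg (a h₀)
    positivity
  · constructor
    · exact Or.inl (Or.inl rfl)
    · rintro x ((rfl | ⟨h, rfl⟩) | rfl)
      · exact le_rfl
      · exact (by decide : 1 ≤ 3)
      · exact (by decide : 1 ≤ 3)
  · constructor
    · exact Or.inl ⟨j, norm_sigmoidHead_WKQ _ _ _⟩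
    · rintro x (⟨h, rfl⟩ | h)
      · exact (norm_sigmoidHead_WKQ _ _ _).trans_le (hj h)
      · exact h.elim
  · constructor
    · exact Or.inl ⟨i, norm_sigmoidHead_WV _ _ _⟩
    · rintro x (⟨h, rfl⟩ | h)
      · exact (norm_sigmoidHead_WV _ _ _).trans_le (hi h)
      · exact h.elim

end AttnOnly

/-! ### Exponentials from shifted sigmoids -/

/-- With `x = exp (-t) ^ e` and `r = 2^(-q)`, the scaled sigmoid is `x / (1 + x r)`, which differs
from `x` by `x² r / (1 + x r) ≤ r`. -/
theorem abs_scaled_sigmoid_sub_pow_le (e q : ℕ) {t : ℝ} (ht : 0 ≤ t) :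
    |2 ^ q * (Real.exp (-(e * t + q * Real.log 2)) /
      (Real.exp (-(e * t + q * Real.log 2)) + 1)) - Real.exp (-t) ^ e| ≤ (1 / 2) ^ q := by
  have hE : Real.exp (-(e * t + q * Real.log 2)) = Real.exp (-t) ^ e * (1 / 2) ^ q := by
    rw [← Real.exp_nat_mul, neg_add, Real.exp_add, ← mul_neg, ← mul_neg, Real.exp_nat_mul _ q,
      Real.exp_neg, Real.exp_log two_pos, one_div]
  rw [hE]
  have hx0 : 0 ≤ Real.exp (-t) ^ e := by positivity
  have hx1 : Real.exp (-t) ^ e ≤ 1 := pow_le_one₀ (by positivity) (by simpa using ht)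
  have hr : (2 : ℝ) ^ q * (1 / 2) ^ q = 1 := by rw [← mul_pow]; norm_num
  have hr0 : (0 : ℝ) < (1 / 2) ^ q := by positivity
  set x := Real.exp (-t) ^ e
  set r : ℝ := (1 / 2) ^ q
  have e1 : 2 ^ q * (x * r / (x * r + 1)) - x = -(x * (x * r) / (x * r + 1)) := by
    have : x * r + 1 ≠ 0 := by positivity
    field_simp
    linear_combination x * hr
  rw [e1, abs_neg, abs_of_nonneg (by positivity), div_le_iff₀ (by positivity)]
  nlinarith [mul_nonneg hx0 hr0.le, mul_nonneg hr0.le hr0.le,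
    mul_nonneg hx0 (mul_nonneg hr0.le hr0.le), mul_le_mul hx1 hx1 hx0 zero_le_one]

namespace AttnOnly

/-- Exponential sums are approximated by single-layer attention-only Transformers. -/
theorem exists_transformer_approx_expSum {ι : Type*} [Fintype ι] (c : ι → ℝ) (e : ι → ℕ)
    {D : ℝ} {q : ℕ} (hq : 1 ≤ q) (hc : ∀ i, |c i| ≤ D) (he : ∀ i, e i ≤ 2 ^ q) {i₀ : ι}
    (hi₀ : c i₀ ≠ 0) :
    ∃ CKQ CV : ℝ, CKQ ≤ 2 ∧ CV ≤ D * 2 ^ q ∧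
      ∃ f ∈ TransformerClass 1 1 1 (Fintype.card ι) 3 1 (2 ^ q) CKQ CV, ∀ t : ℝ, 0 ≤ t →
        |f (Matrix.of fun _ _ => t) 0 0 - ∑ i, c i * Real.exp (-t) ^ e i|
          ≤ Fintype.card ι * (D * (1 / 2) ^ q) := by
  have hlog : 0 < Real.log 2 := Real.log_pos one_lt_two
  have hq0 : (0 : ℝ) < q := by exact_mod_cast hq
  have hlam : (0 : ℝ) < 2 ^ q := by positivity
  let σ := (Fintype.equivFin ι).symm
  -- Slope and shift are divided by `2 ^ q`, which the inverse temperature restores; this keeps the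
  -- key-query norms bounded.
  obtain ⟨CKQ, CV, hKQ, hV, f, hf, hft⟩ := exists_transformer_eq_sum_sigmoid
    (lam := 2 ^ q) (V := D * 2 ^ q) (R := 2) hlam
    (fun h => c (σ h) * 2 ^ q) (fun h => e (σ h) / 2 ^ q) (fun _ => q * Real.log 2 / 2 ^ q)
    (h₀ := σ.symm i₀) (by simpa using hi₀) (by positivity)
    (fun h => by
      rw [abs_mul, abs_of_pos hlam]
      exact mul_le_mul_of_nonneg_right (hc _) hlam.le)
    (fun h => by
      have ha : (e (σ h) : ℝ) / 2 ^ q ≤ 1 := by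
        rw [div_le_one hlam]; exact_mod_cast he _
      have hb : q * Real.log 2 / 2 ^ q ≤ 1 := by
        rw [div_le_one hlam]
        have h1 : (q : ℝ) ≤ 2 ^ q := by exact_mod_cast (Nat.lt_two_pow_self (n := q)).le
        have h2 : Real.log 2 ≤ 1 := by linarith [Real.log_two_lt_d9]
        nlinarith
      have ha' := pow_le_one₀ (n := 2) (by positivity) ha
      have hb' := pow_le_one₀ (n := 2) (by positivity) hb
      rw [Real.sqrt_le_left (by norm_num)]
      linarith)
  refine ⟨CKQ, CV, hKQ, hV, f, hf, fun t ht => ?_⟩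
  have harg : ∀ i, (2 : ℝ) ^ q * (e i / 2 ^ q * t + q * Real.log 2 / 2 ^ q) =
      e i * t + q * Real.log 2 := fun i => by field_simp
  simp only [hft, harg]
  rw [Equiv.sum_comp σ fun i => c i * 2 ^ q * (Real.exp (-(e i * t + q * Real.log 2)) /
    (Real.exp (-(e i * t + q * Real.log 2)) + 1)), ← Finset.sum_sub_distrib]
  refine (Finset.abs_sum_le_sum_abs _ _).trans ?_
  have hb : ∀ i ∈ Finset.univ, |c i * 2 ^ q * (Real.exp (-(e i * t + q * Real.log 2)) /
      (Real.exp (-(e i * t + q * Real.log 2)) + 1)) - c i * Real.exp (-t) ^ e i|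
      ≤ D * (1 / 2) ^ q := by
    intro i _
    rw [mul_assoc, ← mul_sub, abs_mul]
    exact mul_le_mul (hc i) (abs_scaled_sigmoid_sub_pow_le (e i) q ht) (abs_nonneg _)
      ((abs_nonneg _).trans (hc i))
  simpa using Finset.sum_le_card_nsmul _ _ _ hb

/-! ### Choice of parameters and error budget -/

theorem one_sub_exp_neg_ge {n : ℕ} {t : ℝ} (ht : (1 / 2 : ℝ) ^ n ≤ t) :
    (1 / 2 : ℝ) ^ (n + 1) ≤ 1 - Real.exp (-t) := by
  have h0 : (0 : ℝ) < (1 / 2) ^ n := by positivity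
  have h1 : (1 / 2 : ℝ) ^ n ≤ 1 := pow_le_one₀ (by norm_num) (by norm_num)
  have hx : Real.exp (-t) ≤ 1 / (1 + (1 / 2) ^ n) := by
    rw [Real.exp_neg, ← one_div]
    exact one_div_le_one_div_of_le (by positivity) (by linarith [Real.add_one_le_exp t])
  refine le_trans ?_ (sub_le_sub_left hx 1)
  rw [pow_succ, le_sub_comm, div_le_iff₀ (by positivity)]
  nlinarith

/-- The numerator is at most `2^(-(2n+3))`, as `exp s ≥ s`; the denominator costs a factor
`2^(n+1)`. This is the tail of the power series. -/
theorem exp_neg_pow_div_le {n : ℕ} {t : ℝ} (ht : (1 / 2 : ℝ) ^ n ≤ t) :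
    Real.exp (-t) ^ (2 ^ (3 * n + 3)) / (1 - Real.exp (-t)) ≤ (1 / 2) ^ (n + 2) := by
  have hg := one_sub_exp_neg_ge ht
  have hg0 : (0 : ℝ) < (1 / 2) ^ (n + 1) := by positivity
  rw [div_le_iff₀ (hg0.trans_le hg)]
  refine le_trans ?_ (mul_le_mul_of_nonneg_left hg (by positivity))
  rw [← Real.exp_nat_mul, mul_neg, Real.exp_neg]
  have h2 : (2 : ℝ) ^ (2 * n + 3) ≤ Real.exp (((2 ^ (3 * n + 3) : ℕ) : ℝ) * t) := by
    have h3 : (2 : ℝ) ^ (2 * n + 3) = 2 ^ (3 * n + 3) * (1 / 2) ^ n := by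
      rw [show 3 * n + 3 = 2 * n + 3 + n by omega, pow_add _ (2 * n + 3) n, mul_assoc, ← mul_pow]
      norm_num
    have h4 : (2 : ℝ) ^ (3 * n + 3) * (1 / 2) ^ n ≤ ((2 ^ (3 * n + 3) : ℕ) : ℝ) * t := by
      push_cast
      gcongr
    linarith [Real.add_one_le_exp (((2 ^ (3 * n + 3) : ℕ) : ℝ) * t)]
  refine (inv_anti₀ (by positivity) h2).trans (le_of_eq ?_)
  rw [← pow_add, ← inv_pow, one_div]
  congr 1
  omega

/-- Approximation of `√(1 - exp (-t))` for `t ≥ 2 ^ (-n)` up to the error `2 ^ (-n)`. -/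
theorem exists_transformer_approx_sqrt {n : ℕ} (hn : 1 ≤ n) :
    ∃ (H : ℕ) (CKQ CV : ℝ), H ≤ 109 * n ^ 2 ∧ CKQ ≤ 2 ∧ CV ≤ 2 ^ (268 * n ^ 2) ∧
      ∃ f ∈ TransformerClass 1 1 1 H 3 1 (2 ^ (190 * n ^ 2)) CKQ CV,
        ∀ t : ℝ, (1 / 2) ^ n ≤ t →
          |f (Matrix.of fun _ _ => t) 0 0 - Real.sqrt (1 - Real.exp (-t))| ≤ (1 / 2) ^ n := by
  have hn2 : n ≤ n ^ 2 := by nlinarith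
  obtain ⟨w, hw, hsqrt⟩ := exists_sqrt_one_sub_approx
  -- `2^(3n+3)` terms, each off by at most `2^(-(4n+5))`, give a total of `2^(-(n+2))`.
  obtain ⟨B, c, hB, hBle, hc, hcomp⟩ := exists_sparse_approx w hw (3 * n + 2) (4 * n + 5)
  let s := B ×ˢ Finset.range (4 * n + 5)
  have hs : Fintype.card (Option s) ≤ 109 * n ^ 2 := by
    rw [Fintype.card_option, Fintype.card_coe, Finset.card_product, Finset.card_range]
    nlinarith
  have hcD : ∀ N l, |c N l| ≤ 2 ^ (78 * n ^ 2) := by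
    intro N l
    refine (hc N l).trans ?_
    have hm : ((4 * n + 5 : ℕ) : ℝ) ≤ 2 ^ (4 * n + 5) := by
      exact_mod_cast Nat.lt_two_pow_self.le
    calc (2 : ℝ) ^ (3 * n + 2 + 1) * (((4 * n + 5 : ℕ) : ℝ) *
          ((2 ^ (3 * n + 2 + 1)) ^ (4 * n + 5) * 2 ^ (4 * n + 5)))
        ≤ 2 ^ (3 * n + 2 + 1) * (2 ^ (4 * n + 5) *
          ((2 ^ (3 * n + 2 + 1)) ^ (4 * n + 5) * 2 ^ (4 * n + 5))) := by gcongr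
      _ = 2 ^ (3 * n + 2 + 1 + (4 * n + 5 + ((3 * n + 2 + 1) * (4 * n + 5) + (4 * n + 5)))) := by
        simp only [pow_add, pow_mul]
      _ ≤ 2 ^ (78 * n ^ 2) := by
        refine pow_le_pow_right₀ one_le_two ?_
        nlinarith
  -- `none` carries the constant term 1 of the series, and supplies the nonzero coefficient that
  -- makes the norms positive.
  let c' : Option s → ℝ := fun i => i.elim 1 fun i => c i.1.1 i.1.2
  let e' : Option s → ℕ := fun i => i.elim 0 fun i => i.1.1 + i.1.2 + 1
  -- `190 = 109 + 78 + 3`: head count, coefficient size, and a surplus for the error.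
  obtain ⟨CKQ, CV, hKQ, hV, f, hf, hft⟩ := exists_transformer_approx_expSum c' e'
    (D := 2 ^ (78 * n ^ 2)) (q := 190 * n ^ 2) (i₀ := none) (by nlinarith)
    (by
      rintro (_ | i)
      · simpa [c'] using one_le_pow₀ (M₀ := ℝ) one_le_two
      · exact hcD _ _)
    (by
      rintro (_ | i)
      · exact Nat.zero_le _
      · obtain ⟨h1, h2⟩ := Finset.mem_product.1 i.2
        have h1 := hBle _ h1
        have h2 := Finset.mem_range.1 h2
        have h3 : 10 * n < 2 ^ (10 * n) := Nat.lt_two_pow_self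
        have h4 : 2 ^ (3 * n + 2 + 1) ≤ 2 ^ (10 * n) :=
          Nat.pow_le_pow_right two_pos (by omega)
        have h5 : 2 ^ (10 * n + 1) ≤ 2 ^ (190 * n ^ 2) :=
          Nat.pow_le_pow_right two_pos (by omega)
        rw [pow_succ] at h5
        change i.1.1 + i.1.2 + 1 ≤ _
        omega)
    (by simp [c'])
  refine ⟨_, CKQ, CV, hs, hKQ, hV.trans ?_, f, hf, fun t ht => ?_⟩
  · rw [← pow_add]
    exact pow_le_pow_right₀ one_le_two (by omega)
  have ht0 : 0 ≤ t := le_trans (by positivity) ht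
  have hy0 : 0 ≤ Real.exp (-t) := (Real.exp_pos _).le
  have hy1 : Real.exp (-t) ≤ 1 := by simpa using ht0
  have hy1' : Real.exp (-t) < 1 := by
    have := one_sub_exp_neg_ge ht
    have : (0 : ℝ) < (1 / 2) ^ (n + 1) := by positivity
    linarith
  have h1 := hft t ht0
  have h2 := hcomp _ hy0 hy1
  have h3 := (hsqrt _ hy0 hy1' (2 ^ (3 * n + 3))).trans (exp_neg_pow_div_le ht)
  have hsum : ∑ i, c' i * Real.exp (-t) ^ e' i = 1 + Real.exp (-t) *
      ∑ q ∈ s, c q.1 q.2 * Real.exp (-t) ^ (q.1 + q.2) := by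
    rw [Fintype.sum_option, Finset.mul_sum, ← Finset.sum_coe_sort s]
    congr 1
    · simp [c', e']
    · refine Finset.sum_congr rfl fun i _ => ?_
      simp only [c', e', Option.elim]
      ring
  have herr : (Fintype.card (Option s) : ℝ) * (2 ^ (78 * n ^ 2) * (1 / 2) ^ (190 * n ^ 2))
      ≤ (1 / 2) ^ (n + 2) := by
    have hH : (Fintype.card (Option s) : ℝ) ≤ 2 ^ (109 * n ^ 2) := by
      exact_mod_cast hs.trans Nat.lt_two_pow_self.le
    calc _ ≤ (2 : ℝ) ^ (109 * n ^ 2) * (2 ^ (78 * n ^ 2) * (1 / 2) ^ (190 * n ^ 2)) := by gcongr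
      _ = (1 / 2) ^ (3 * n ^ 2) := by
        rw [← mul_assoc, ← pow_add, show 190 * n ^ 2 = 109 * n ^ 2 + 78 * n ^ 2 + 3 * n ^ 2 by ring,
          pow_add (1 / 2 : ℝ) _ (3 * n ^ 2), ← mul_assoc, ← mul_pow]
        norm_num
      _ ≤ _ := pow_le_pow_of_le_one (by norm_num) (by norm_num) (by omega)
  have hcomp_err : (2 : ℝ) ^ (3 * n + 2 + 1) * (1 / 2) ^ (4 * n + 5) = (1 / 2) ^ (n + 2) := by
    rw [show 4 * n + 5 = 3 * n + 2 + 1 + (n + 2) by ring, pow_add (1 / 2 : ℝ) _ (n + 2),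
      ← mul_assoc, ← mul_pow]
    norm_num
  rw [hcomp_err] at h2
  have h1 := h1.trans herr
  rw [hsum] at h1
  have h2' : |Real.exp (-t) * (∑ k ∈ Finset.range (2 ^ (3 * n + 2 + 1)), w k * Real.exp (-t) ^ k
      - ∑ q ∈ s, c q.1 q.2 * Real.exp (-t) ^ (q.1 + q.2))| ≤ (1 / 2) ^ (n + 2) := by
    rw [abs_mul, abs_of_nonneg hy0]
    exact (mul_le_of_le_one_left (abs_nonneg _) hy1).trans h2
  rw [mul_sub] at h2'
  -- The sigmoid, compression and tail errors each take a quarter of the budget.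
  have h4 : (1 / 2 : ℝ) ^ (n + 2) = (1 / 2) ^ n / 4 := by rw [pow_add]; norm_num; ring
  have h5 : (0 : ℝ) < (1 / 2) ^ n := by positivity
  rw [h4, abs_le] at h1 h2' h3
  rw [abs_le]
  constructor <;> linarith [h1.1, h1.2, h2'.1, h2'.2, h3.1, h3.2]

end AttnOnly

/-! ### From powers of two to `ε` -/

theorem two_pow_le_exp (k : ℕ) : (2 : ℝ) ^ k ≤ Real.exp k := by
  rw [← mul_one (k : ℝ), Real.exp_nat_mul]
  exact pow_le_pow_left₀ zero_le_two (by linarith [Real.add_one_le_exp (1 : ℝ)]) k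

theorem mainTheorem9 :
    ∃ (C : ℝ) (p : Polynomial ℝ), 0 < C ∧
      ∀ ε : ℝ, 0 < ε → ε < 1 → ∀ CX : ℝ, ε < CX →
        ∃ (H W K : ℕ) (lam CKQ CV : ℝ),
        ∃ f ∈ AttnOnly.TransformerClass 1 1 1 H W K lam CKQ CV,
          (∀ t : ℝ, ε ≤ t → t ≤ CX →
            |f (Matrix.of fun _ _ => t) 0 0 - Real.sqrt (1 - Real.exp (-t))| ≤ ε) ∧
          (ε ≤ 1 / 2 → 1 ≤ CX →
            (H : ℝ) ≤ C * Real.log (1 / ε) ^ 3 ∧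
            (W : ℝ) ≤ C * Real.log (1 / ε) ^ 3 ∧
            (K : ℝ) ≤ C * Real.log (1 / ε) ^ 2 ∧
            CV ≤ Real.exp (C * Real.log (1 / ε) ^ 2) *
              (C * Real.sqrt (Real.log (1 / ε) ^ 3)) ∧
            CKQ ≤ C * Real.sqrt
              (Real.log (1 / ε) ^ 2 * (Real.log (1 / ε) ^ 2 + Real.log CX)) ∧
            lam ≤ Real.exp (C * Real.log (1 / ε) ^ 4) *
              (C * (Real.log (1 / ε) ^ (p.eval (Real.log (1 / ε))) * (1 + Real.log CX)))) := by
  -- With `p = 0` the factor `(ln δ)^p` is 1. The constant is generous: the largest demand is `190 *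
  -- 9 * 3`, from `lam`.
  refine ⟨10000, 0, by norm_num, fun ε h0 h1 CX _ => ?_⟩
  have hL0 : 0 < Real.log (1 / ε) := Real.log_pos (by rwa [lt_div_iff₀ h0, one_mul])
  obtain ⟨n, hn⟩ : ∃ n, n = ⌈Real.log (1 / ε) / Real.log 2⌉₊ := ⟨_, rfl⟩
  have hlog : 0 < Real.log 2 := Real.log_pos one_lt_two
  have hn1 : 1 ≤ n := by rw [hn]; exact Nat.one_le_ceil_iff.2 (by positivity)
  have hnε : (1 / 2 : ℝ) ^ n ≤ ε := by
    have h : Real.log (1 / ε) / Real.log 2 ≤ n := hn ▸ Nat.le_ceil _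
    rw [div_le_iff₀ hlog, ← Real.log_pow, Real.log_le_log_iff (by positivity) (by positivity),
      one_div, inv_le_comm₀ h0 (by positivity)] at h
    simpa using h
  obtain ⟨H, CKQ, CV, hH, hKQ, hV, f, hf, happ⟩ := AttnOnly.exists_transformer_approx_sqrt hn1
  refine ⟨H, 3, 1, _, CKQ, CV, f, hf, fun t ht _ => (happ t (hnε.trans ht)).trans hnε,
    fun h2 hCX => ?_⟩
  have hL : Real.log 2 ≤ Real.log (1 / ε) :=
    Real.log_le_log two_pos (by rw [le_div_iff₀ h0]; linarith)
  have hl2 := Real.log_two_gt_d9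
  have hn3 : (n : ℝ) ≤ 3 * Real.log (1 / ε) := by
    have h : (n : ℝ) < Real.log (1 / ε) / Real.log 2 + 1 := hn ▸ Nat.ceil_lt_add_one (by positivity)
    have h' : Real.log (1 / ε) / Real.log 2 + 1 ≤ 3 * Real.log (1 / ε) := by
      rw [div_add_one hlog.ne', div_le_iff₀ hlog]
      nlinarith
    linarith
  have hX : 0 ≤ Real.log CX := Real.log_nonneg hCX
  set l := Real.log (1 / ε)
  have hl : 0.69 ≤ l := by linarith
  have hl2' : 0.47 ≤ l ^ 2 := by nlinarith
  have hl3 : 0.32 ≤ l ^ 3 := by nlinarith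
  have hl23 : l ^ 2 ≤ 2 * l ^ 3 := by nlinarith
  have hl24 : l ^ 2 ≤ 3 * l ^ 4 := by nlinarith
  have hn9 : (n : ℝ) ^ 2 ≤ 9 * l ^ 2 := by
    have : (0 : ℝ) ≤ n := n.cast_nonneg
    nlinarith
  have hexp : ∀ k : ℕ, (2 : ℝ) ^ (k * n ^ 2) ≤ Real.exp (9 * k * l ^ 2) := fun k => by
    refine (two_pow_le_exp _).trans (Real.exp_le_exp.2 ?_)
    push_cast
    have : (0 : ℝ) ≤ k := k.cast_nonneg
    nlinarith
  refine ⟨?_, ?_, ?_, ?_, ?_, ?_⟩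
  · have : (H : ℝ) ≤ 109 * (n : ℝ) ^ 2 := by exact_mod_cast hH
    linarith
  · push_cast; linarith
  · push_cast; linarith
  · have hs : 1 ≤ 10000 * Real.sqrt (l ^ 3) := by
      have : (0.1 : ℝ) ≤ Real.sqrt (l ^ 3) := Real.le_sqrt_of_sq_le (by linarith)
      linarith
    refine hV.trans ((hexp 268).trans ?_)
    refine le_trans ?_ (le_mul_of_one_le_right (Real.exp_pos _).le hs)
    refine Real.exp_le_exp.2 ?_
    push_cast; linarith
  · have : (0.1 : ℝ) ≤ Real.sqrt (l ^ 2 * (l ^ 2 + Real.log CX)) :=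
      Real.le_sqrt_of_sq_le (by nlinarith [mul_nonneg (sq_nonneg l) hX])
    linarith
  · refine (hexp 190).trans ?_
    rw [Polynomial.eval_zero, Real.rpow_zero, one_mul]
    refine le_trans ?_ (le_mul_of_one_le_right (Real.exp_pos _).le (by linarith))
    refine Real.exp_le_exp.2 ?_
    push_cast; linarith
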